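/- Let $1<p<\infty$ and let $X=(X,d,\mu)$ be a complete metric space equipped with a complete Borel measure $\mu$ (defined on the completion of the Borel $\sigma$-algebra) which is doubling ($0<\mu(2B)\le C\mu(B)<\infty$ for all balls $B$) and supports a $p$-Poincaré inequality: there are $C>0$ and $\lambda\ge1$ such that for all balls $B$, all integrable $f$ on $X$ and all $p$-weak upper gradients $g$ of $f$, with $f_B=\mu(B)^{-1}\int_B f\,d\mu$, $$\frac1{\mu(B)}\int_B|f-f_B|\,d\mu\le C\operatorname{diam}(B)\Bigl(\frac1{\mu(\lambda B)}\int_{\lambda B}g^p\,d\mu\Bigr)^{1/p}.$$ Here, on a metric measure space $Z$, a measurable $g:Z\to[0,\infty]$ is a $p$-weak upper gradient of $f:Z\to[-\infty,\infty]$ if $|f(\gamma(0))-f(\gamma(l_\gamma))|\le\int_\gamma g\,ds$ (the left-hand side being $\infty$ if either term is infinite) for all nonconstant compact rectifiable curves $\gamma:[0,l_\gamma]\to Z$, parameterized by arc length, outside a family $\Gamma$ for which there is $0\le\rho\in L^p(Z)$ with $\int_\gamma\rho\,ds=\infty$ for all $\gamma\in\Gamma$. Let $\Omega\subset X$ be a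 nonempty bounded open set whose complement has positive Sobolev capacity, $C_p(X\setminus\Omega)>0$. Let $\overline\Omega^1=\Omega\cup\partial^1\Omega$, with topology $\tau^1$, be any compactification of $\Omega$, i.e. a compact Hausdorff space containing $\Omega$ (with its given topology) as a dense subspace, where $\partial^1\Omega=\overline\Omega^1\setminus\Omega$. For a metric measure space $(Z,\mu)$ and measurable $f:Z\to[-\infty,\infty]$ let $$\|f\|_{N^{1,p}(Z)}=\Bigl(\int_Z|f|^p\,d\mu+\inf_g\int_Z g^p\,d\mu\Bigr)^{1/p},$$ the infimum being over all $p$-weak upper gradients $g$ of $f$ on $Z$; let $N^{1,p}(Z)$ be the set of those $f$ for which this is finite; and let $C_p(E)=\inf_u\|u\|^p_{N^{1,p}(X)}$, the infimum being over all $u\in N^{1,p}(X)$ with $u\ge1$ on $E\subset X$. For $E\subset\overline\Omega^1$ let $$\overline{C}_p(E;\Omega^1)=\inf_u\|u\|_{N^{1,p}(\Omega)}^p,$$ where the infimum is over all $u\in N^{1,p}(\Omega)$ (with $\Omega$ regarded as a metric measure space in its own right, with the restricted metric and measure) such that $u\ge1$ on $E\cap\Omega$ and $\liminf_{\Omega\ni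 y\to x}u(y)\ge1$, with the limit taken in $\tau^1$, for all $x\in E\cap\partial^1\Omega$. Then $$\overline{C}_p(\partial^1\Omega;\Omega^1)>0.$$ -/

import Mathlib

open MeasureTheory Metric Set Filter Topology
open scoped ENNReal NNReal

/-- A nonconstant compact rectifiable curve `γ : [0, l_γ] → X`, parameterized by arc length.
The function `toFun` only matters on `[0, len]`; `HasUnitSpeedOn` says that the part of the curve
between the parameters `s ≤ t` has length `t - s`. Since the parameter is arc length, the curve is
nonconstant exactly when `0 < len`. -/
structure RectCurve (X : Type*) [MetricSpace X] where
  len : ℝ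
  len_pos : 0 < len
  toFun : ℝ → X
  unitSpeed : HasUnitSpeedOn toFun (Icc 0 len)

/-- The line integral `∫_γ g ds`. -/
noncomputable def RectCurve.lineIntegral {X : Type*} [MetricSpace X] (γ : RectCurve X)
    (g : X → ℝ≥0∞) : ℝ≥0∞ :=
  ∫⁻ t in Icc 0 γ.len, g (γ.toFun t)

/-- The curve family `Γ` has zero `p`-modulus: there is a nonnegative (Borel) function
`ρ ∈ L^p(X)` with `∫_γ ρ ds = ∞` for every `γ ∈ Γ`. -/
def ZeroModulus {X : Type*} [MetricSpace X] [MeasurableSpace X] (p : ℝ) (μ : Measure X)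
    (Γ : Set (RectCurve X)) : Prop :=
  ∃ ρ : X → ℝ≥0∞, Measurable ρ ∧ ∫⁻ x, ρ x ^ p ∂μ < ∞ ∧ ∀ γ ∈ Γ, γ.lineIntegral ρ = ∞

/-- `g` is a `p`-weak upper gradient of `f`. The measure is regarded as complete, so "measurable"
means measurable with respect to the `μ`-completion of the Borel sets, i.e. `AEMeasurable`.
The difference `a - b` in `EReal` is infinite as soon as `a` or `b` is, so the left-hand
side below is `∞` whenever one of its terms is infinite. -/
def IsWeakUpperGradient {X : Type*} [MetricSpace X] [MeasurableSpace X] (p : ℝ) (μ : Measure X)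
    (g : X → ℝ≥0∞) (f : X → EReal) : Prop :=
  AEMeasurable g μ ∧
    ZeroModulus p μ
      {γ : RectCurve X | ¬ (f (γ.toFun 0) - f (γ.toFun γ.len)).abs ≤ γ.lineIntegral g}

/-- The Newtonian norm
`‖f‖_{N^{1,p}(X)} = (∫ |f|^p dμ + inf_g ∫ g^p dμ)^{1/p}`, the infimum being over all
`p`-weak upper gradients `g` of `f`. -/
noncomputable def newtonNorm {X : Type*} [MetricSpace X] [MeasurableSpace X] (p : ℝ)
    (μ : Measure X) (f : X → EReal) : ℝ≥0∞ :=
  (∫⁻ x, (f x).abs ^ p ∂μ +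
    ⨅ (g : X → ℝ≥0∞) (_ : IsWeakUpperGradient p μ g f), ∫⁻ x, g x ^ p ∂μ) ^ (1 / p)

/-- The Newtonian space `N^{1,p}(X)`, of everywhere defined extended real-valued functions. -/
def newtonSpace {X : Type*} [MetricSpace X] [MeasurableSpace X] (p : ℝ)
    (μ : Measure X) : Set (X → EReal) :=
  {f | AEMeasurable f μ ∧ newtonNorm p μ f < ∞}

/-- The Sobolev capacity `C_p(E)`. -/
noncomputable def sobolevCapacity {X : Type*} [MetricSpace X] [MeasurableSpace X] (p : ℝ)
    (μ : Measure X) (E : Set X) : ℝ≥0∞ :=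
  ⨅ (u : X → EReal) (_ : u ∈ newtonSpace p μ ∧ ∀ x ∈ E, 1 ≤ u x), newtonNorm p μ u ^ p

/-- `μ` is doubling: `0 < μ(2B) ≤ C μ(B) < ∞` for all balls `B`. In particular all balls have
positive and finite measure. -/
def DoublingMeasure {X : Type*} [MetricSpace X] [MeasurableSpace X] (μ : Measure X) : Prop :=
  ∃ C : ℝ≥0, 0 < C ∧ ∀ (x : X) (r : ℝ), 0 < r →
    0 < μ (ball x (2 * r)) ∧ μ (ball x (2 * r)) ≤ C * μ (ball x r) ∧ C * μ (ball x r) < ∞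

/-- `(X, μ)` supports a `p`-Poincaré inequality. -/
def SupportsPoincare {X : Type*} [MetricSpace X] [MeasurableSpace X] (p : ℝ)
    (μ : Measure X) : Prop :=
  ∃ C Λ : ℝ, 0 < C ∧ 1 ≤ Λ ∧ ∀ (x : X) (r : ℝ), 0 < r →
    ∀ (f : X → ℝ) (g : X → ℝ≥0∞), Integrable f μ →
      IsWeakUpperGradient p μ g (fun y => (f y : EReal)) →
      ENNReal.ofReal (⨍ y in ball x r, |f y - ⨍ z in ball x r, f z ∂μ| ∂μ) ≤
        ENNReal.ofReal (C * diam (ball x r)) *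
          (⨍⁻ y in ball x (Λ * r), g y ^ p ∂μ) ^ (1 / p)

/-- `ι : Ω → Y` exhibits the compact Hausdorff space `Y` as a compactification of `Ω`: `ι` is a
homeomorphism onto a dense subset of `Y`. -/
structure IsCompactification {Ω Y : Type*} [TopologicalSpace Ω] [TopologicalSpace Y]
    (ι : Ω → Y) : Prop where
  compact : CompactSpace Y
  hausdorff : T2Space Y
  embedding : IsEmbedding ι
  dense : DenseRange ι

/-- The boundary `∂¹Ω = Y \ Ω` of `Ω` in the compactification `ι : Ω → Y`. -/
def compBoundary {Ω Y : Type*} (ι : Ω → Y) : Set Y := (range ι)ᶜ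

/-- The class `𝒜_E(Ω¹)` of functions in `N^{1,p}(Ω)` admissible for a subset `E` of the
compactification `ι : Ω → Y`. The filter `comap ι (𝓝 x)` describes `Ω ∋ y → x`
in the topology of `Y`. -/
def capAdmissible {Ω Y : Type*} [MetricSpace Ω] [MeasurableSpace Ω] [TopologicalSpace Y]
    (p : ℝ) (μ : Measure Ω) (ι : Ω → Y) (E : Set Y) : Set (Ω → EReal) :=
  {u | u ∈ newtonSpace p μ ∧ (∀ y, ι y ∈ E → 1 ≤ u y) ∧
    ∀ x ∈ E ∩ compBoundary ι, 1 ≤ liminf u (comap ι (𝓝 x))}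

/-- The capacity `C̅_p(E; Ω¹)` of a subset `E` of the compactification `ι : Ω → Y`. -/
noncomputable def barCapacity {Ω Y : Type*} [MetricSpace Ω] [MeasurableSpace Ω]
    [TopologicalSpace Y] (p : ℝ) (μ : Measure Ω) (ι : Ω → Y) (E : Set Y) : ℝ≥0∞ :=
  ⨅ u ∈ capAdmissible p μ ι E, newtonNorm p μ u ^ p

/-!
The boundary capacity is positive because functions that witness its vanishing would approximate
the indicator function of `Ω` on `X` with gradients tending to zero.

Let `u` be admissible for the boundary of the compactification. By compactness, `u > 1 / 2` on `Ω`
outside a compact set `K ⊆ Ω` (`exists_isCompact_forall_half_lt`). Hence `h = min 1 (2 |u|)`,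
extended by `1` to `X \ Ω`, is identically `1` near the complement of `Ω`, and twice a weak upper
gradient of `u`, extended by zero, is a weak upper gradient of `h` on `X`
(`isWeakUpperGradient_truncExtend`). If the boundary capacity is zero, then `h` can be taken
arbitrarily small in `L^p(Ω)`, with an arbitrarily small gradient
(`exists_small_of_barCapacity_eq_zero`). There are two cases.

* If `X \ Ω` is a null set, then `h` is small in `N^{1,p}(X)` and equals `1` on `X \ Ω`, which
  forces `C_p(X \ Ω) = 0`.
* Otherwise some ball `B` contains `Ω` and meets `X \ Ω` in positive measure. The function `1 - h`
  vanishes on `B \ Ω` and has mean on `B` bounded from below (`quarter_le_setIntegral_one_sub`), so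
  its mean oscillation on `B` is bounded from below (`setAverage_mul_le_setAverage_abs_sub`), which
  contradicts the Poincaré inequality on `B`.
-/

/-! ### Reversal and initial pieces of rectifiable curves -/

namespace RectCurve

variable {X : Type*} [MetricSpace X]

theorem continuousOn (γ : RectCurve X) : ContinuousOn γ.toFun (Icc 0 γ.len) := by
  have h : LipschitzOnWith 1 γ.toFun (Icc 0 γ.len) := by
    intro x hx y hy
    wlog hxy : x ≤ y generalizing x y
    · rw [edist_comm, edist_comm x y]
      exact this hy hx (le_of_not_ge hxy)
    have hv := γ.unitSpeed hx hy
    have hle := eVariationOn.edist_le γ.toFun (s := Icc 0 γ.len ∩ Icc x y) (x := x) (y := y)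
      ⟨hx, le_rfl, hxy⟩ ⟨hy, hxy, le_rfl⟩
    rw [hv] at hle
    refine hle.trans ?_
    rw [edist_dist, Real.dist_eq, abs_sub_comm, abs_of_nonneg (sub_nonneg.2 hxy)]
    simp
  exact h.continuousOn

/-- The curve run through backwards. -/
def reverse (γ : RectCurve X) : RectCurve X where
  len := γ.len
  len_pos := γ.len_pos
  toFun t := γ.toFun (γ.len - t)
  unitSpeed := by
    intro x hx y hy
    have hanti : AntitoneOn (fun t : ℝ => γ.len - t) (Icc 0 γ.len ∩ Icc x y) :=
      fun a _ b _ hab => sub_le_sub_left hab _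
    have himage : (fun t : ℝ => γ.len - t) '' (Icc 0 γ.len ∩ Icc x y) =
        Icc 0 γ.len ∩ Icc (γ.len - y) (γ.len - x) := by
      rw [Icc_inter_Icc, Icc_inter_Icc, image_const_sub_Icc]
      rw [max_eq_right hx.1, min_eq_right hy.2, max_eq_right (by linarith [hy.2]),
        min_eq_right (by linarith [hx.1])]
    change eVariationOn (γ.toFun ∘ fun t => γ.len - t) _ = _
    rw [eVariationOn.comp_eq_of_antitoneOn _ _ hanti, himage,
      γ.unitSpeed ⟨by linarith [hy.2], by linarith [hy.1]⟩ ⟨by linarith [hx.2], by linarith [hx.1]⟩]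
    congr 2
    ring

theorem lineIntegral_reverse (γ : RectCurve X) (g : X → ℝ≥0∞) :
    γ.reverse.lineIntegral g = γ.lineIntegral g := by
  have h := (Measure.measurePreserving_sub_left (volume : Measure ℝ) γ.len)
    |>.setLIntegral_comp_preimage_emb (MeasurableEquiv.subLeft γ.len).measurableEmbedding
      (fun t => g (γ.toFun t)) (Icc 0 γ.len)
  rw [preimage_const_sub_Icc, sub_self, sub_zero] at h
  exact h

/-- The initial piece `γ|_[0, s]` of a curve, as a curve in a subset `Ω` containing it. The junk
branch of `toFun` concerns only parameters outside `[0, s]`. -/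
noncomputable def initialPiece (γ : RectCurve X) {Ω : Set X} {s : ℝ} (hs0 : 0 < s)
    (hs : s ≤ γ.len) (hΩ : ∀ t ∈ Icc 0 s, γ.toFun t ∈ Ω) : RectCurve Ω where
  len := s
  len_pos := hs0
  toFun t := open Classical in
    if h : γ.toFun t ∈ Ω then ⟨γ.toFun t, h⟩ else ⟨γ.toFun 0, hΩ 0 ⟨le_rfl, hs0.le⟩⟩
  unitSpeed := by
    intro x hx y hy
    have hsub : Icc 0 s ∩ Icc x y = Icc 0 γ.len ∩ Icc x y := by
      rw [Icc_inter_Icc, Icc_inter_Icc, min_eq_right hy.2, min_eq_right (hy.2.trans hs)]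
    rw [← γ.unitSpeed ⟨hx.1, hx.2.trans hs⟩ ⟨hy.1, hy.2.trans hs⟩, ← hsub]
    refine Eq.trans ?_ (eVariationOn.eq_of_edist_zero_on (f := fun t =>
      ((open Classical in if h : γ.toFun t ∈ Ω then (⟨γ.toFun t, h⟩ : Ω)
        else ⟨γ.toFun 0, hΩ 0 ⟨le_rfl, hs0.le⟩⟩ : Ω) : X)) ?_)
    · rfl
    · intro t ht
      simp [hΩ t ht.1]

theorem coe_initialPiece (γ : RectCurve X) {Ω : Set X} {s : ℝ} (hs0 : 0 < s)
    (hs : s ≤ γ.len) (hΩ : ∀ t ∈ Icc 0 s, γ.toFun t ∈ Ω) {t : ℝ} (ht : t ∈ Icc 0 s) :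
    ((γ.initialPiece hs0 hs hΩ).toFun t : X) = γ.toFun t := by
  simp [initialPiece, hΩ t ht]

theorem lineIntegral_initialPiece_le (γ : RectCurve X) {Ω : Set X} {s : ℝ} (hs0 : 0 < s)
    (hs : s ≤ γ.len) (hΩ : ∀ t ∈ Icc 0 s, γ.toFun t ∈ Ω) (g : X → ℝ≥0∞) :
    (γ.initialPiece hs0 hs hΩ).lineIntegral (fun y => g y) ≤ γ.lineIntegral g := by
  refine le_trans (le_of_eq ?_) (lintegral_mono_set (Icc_subset_Icc_right hs))
  exact setLIntegral_congr_fun measurableSet_Icc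
    fun t ht => congrArg g (γ.coe_initialPiece hs0 hs hΩ ht)

/-- A curve that starts in an open set `Ω` and leaves it has an initial piece inside `Ω` that ends
outside any given closed subset `K` of `Ω`: stop shortly before the first exit time. -/
theorem exists_initial_subset {γ : RectCurve X} {Ω K : Set X} (hΩ : IsOpen Ω) (hK : IsClosed K)
    (hKΩ : K ⊆ Ω) (h0 : γ.toFun 0 ∈ Ω) (hexit : ∃ t ∈ Icc 0 γ.len, γ.toFun t ∉ Ω) :
    ∃ s ∈ Icc 0 γ.len, γ.toFun s ∉ K ∧ ∀ t ∈ Icc 0 s, γ.toFun t ∈ Ω := by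
  set T : Set ℝ := Icc 0 γ.len ∩ γ.toFun ⁻¹' Ωᶜ with hT
  have hTc : IsClosed T :=
    γ.continuousOn.preimage_isClosed_of_isClosed isClosed_Icc hΩ.isClosed_compl
  have hTne : T.Nonempty := by
    obtain ⟨t, ht, h⟩ := hexit
    exact ⟨t, ht, h⟩
  have hTb : BddBelow T := ⟨0, fun t ht => ht.1.1⟩
  have hmem : sInf T ∈ T := hTc.csInf_mem hTne hTb
  have hpos : 0 < sInf T := by
    refine lt_of_le_of_ne hmem.1.1 fun h => hmem.2 ?_
    rwa [← h]
  have hcont : Tendsto γ.toFun (𝓝[Ico 0 (sInf T)] sInf T) (𝓝 (γ.toFun (sInf T))) :=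
    (γ.continuousOn _ hmem.1).mono_left
      (nhdsWithin_mono _ fun t ht => ⟨ht.1, ht.2.le.trans hmem.1.2⟩)
  have hev := hcont.eventually (hK.isOpen_compl.mem_nhds fun h => hmem.2 (hKΩ h))
  have hne : (𝓝[Ico 0 (sInf T)] sInf T).NeBot := by
    rw [← mem_closure_iff_nhdsWithin_neBot, closure_Ico hpos.ne]
    exact ⟨hpos.le, le_rfl⟩
  obtain ⟨s, hsK, hs⟩ := (hev.and self_mem_nhdsWithin).exists
  refine ⟨s, ⟨hs.1, hs.2.le.trans hmem.1.2⟩, hsK, fun t ht => ?_⟩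
  by_contra hn
  exact absurd (csInf_le hTb ⟨⟨ht.1, ht.2.trans (hs.2.le.trans hmem.1.2)⟩, hn⟩)
    (not_le.2 (ht.2.trans_lt hs.2))

end RectCurve

/-! ### Truncation of extended real values -/

/-- The truncation `min 1 (2 |a|)` of an extended real number, as a real number in `[0, 1]`. It
equals `1` as soon as `a > 1 / 2`. -/
noncomputable def unitTrunc (a : EReal) : ℝ := (min 1 (2 * a.abs)).toReal

theorem ofReal_unitTrunc (a : EReal) : ENNReal.ofReal (unitTrunc a) = min 1 (2 * a.abs) :=
  ENNReal.ofReal_toReal (ne_top_of_le_ne_top ENNReal.one_ne_top (min_le_left _ _))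

theorem unitTrunc_nonneg (a : EReal) : 0 ≤ unitTrunc a := ENNReal.toReal_nonneg

theorem unitTrunc_le_one (a : EReal) : unitTrunc a ≤ 1 :=
  ENNReal.toReal_le_of_le_ofReal zero_le_one (by simp)

theorem unitTrunc_coe (a : ℝ) : unitTrunc a = min 1 (2 * |a|) := by
  have h : (2 : ℝ≥0∞) * (a : EReal).abs = ENNReal.ofReal (2 * |a|) := by
    rw [EReal.abs_def, ENNReal.ofReal_mul zero_le_two, ENNReal.ofReal_ofNat]
  rw [unitTrunc, h, ← ENNReal.ofReal_one, ← ENNReal.ofReal_min,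
    ENNReal.toReal_ofReal (by positivity)]

theorem unitTrunc_eq_one {a : EReal} (ha : ((1 / 2 : ℝ) : EReal) < a) : unitTrunc a = 1 := by
  induction a with
  | bot => simp at ha
  | top => simp [unitTrunc]
  | coe a =>
    have h : 1 / 2 < a := EReal.coe_lt_coe_iff.1 ha
    rw [unitTrunc_coe, min_eq_left]
    linarith [le_abs_self a]

theorem ofReal_abs_unitTrunc_sub_le (a b : EReal) :
    ENNReal.ofReal |unitTrunc a - unitTrunc b| ≤ 2 * (a - b).abs := by
  induction a with
  | bot => simp
  | top => induction b with
    | bot => simp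
    | top => simp
    | coe b => simp
  | coe a => induction b with
    | bot => simp
    | top => simp
    | coe b =>
      rw [← EReal.coe_sub, EReal.abs_def, ← ENNReal.ofReal_ofNat 2, ← ENNReal.ofReal_mul zero_le_two,
        unitTrunc_coe, unitTrunc_coe]
      refine ENNReal.ofReal_le_ofReal ((abs_min_sub_min_le_max _ _ _ _).trans ?_)
      rw [sub_self, abs_zero, max_eq_right (abs_nonneg _), ← mul_sub, abs_mul, abs_two]
      exact mul_le_mul_of_nonneg_left (abs_abs_sub_abs_le a b) zero_le_two

theorem measurable_unitTrunc : Measurable unitTrunc := by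
  refine EReal.measurable_of_measurable_real ?_
  simp only [unitTrunc_coe]
  fun_prop

/-! ### Extending functions and weak upper gradients from an open subset -/

section Extension

variable {X : Type*}

/-- Extension by zero to `X` of a function on the subset `Ω`. -/
noncomputable def zeroExtend {Ω : Set X} (g : Ω → ℝ≥0∞) : X → ℝ≥0∞ :=
  Function.extend Subtype.val g 0

@[simp]
theorem zeroExtend_coe {Ω : Set X} (g : Ω → ℝ≥0∞) (y : Ω) : zeroExtend g y = g y :=
  Subtype.val_injective.extend_apply _ _ _

theorem zeroExtend_of_notMem {Ω : Set X} (g : Ω → ℝ≥0∞) {x : X} (hx : x ∉ Ω) :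
    zeroExtend g x = 0 :=
  Function.extend_apply' _ _ _ (by rintro ⟨y, rfl⟩; exact hx y.2)

/-- The function on `X` that is the truncation of `u` on `Ω` and `1` outside `Ω`. -/
noncomputable def truncExtend {Ω : Set X} (u : Ω → EReal) : X → ℝ :=
  Function.extend Subtype.val (fun y => unitTrunc (u y)) 1

@[simp]
theorem truncExtend_coe {Ω : Set X} (u : Ω → EReal) (y : Ω) : truncExtend u y = unitTrunc (u y) :=
  Subtype.val_injective.extend_apply _ _ _

theorem truncExtend_of_notMem {Ω : Set X} (u : Ω → EReal) {x : X} (hx : x ∉ Ω) :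
    truncExtend u x = 1 :=
  Function.extend_apply' _ _ _ (by rintro ⟨y, rfl⟩; exact hx y.2)

theorem truncExtend_mem_Icc {Ω : Set X} (u : Ω → EReal) (x : X) : truncExtend u x ∈ Icc 0 1 := by
  by_cases hx : x ∈ Ω
  · lift x to Ω using hx
    rw [truncExtend_coe]
    exact ⟨unitTrunc_nonneg _, unitTrunc_le_one _⟩
  · rw [truncExtend_of_notMem u hx]
    exact ⟨zero_le_one, le_rfl⟩

variable [MeasurableSpace X] {μ : Measure X} {Ω : Set X}

theorem aemeasurable_zeroExtend (hΩ : MeasurableSet Ω) {g : Ω → ℝ≥0∞}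
    (hg : AEMeasurable g (μ.comap (Subtype.val : Ω → X))) : AEMeasurable (zeroExtend g) μ := by
  have h : zeroExtend g = Ω.indicator (zeroExtend g) := by
    rw [eq_comm, indicator_eq_self]
    exact Function.support_subset_iff'.2 fun x hx => zeroExtend_of_notMem g hx
  rw [h, aemeasurable_indicator_iff hΩ, aemeasurable_restrict_iff_comap_subtype hΩ]
  exact hg.congr (.of_forall fun y => by simp)

theorem lintegral_zeroExtend_rpow (hΩ : MeasurableSet Ω) (g : Ω → ℝ≥0∞) {p : ℝ} (hp : 0 < p) :
    ∫⁻ x, zeroExtend g x ^ p ∂μ = ∫⁻ y, g y ^ p ∂(μ.comap (Subtype.val : Ω → X)) := by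
  rw [← setLIntegral_eq_of_support_subset (s := Ω), ← lintegral_subtype_comap hΩ]
  · simp
  · refine Function.support_subset_iff'.2 fun x hx => ?_
    rw [zeroExtend_of_notMem g hx, ENNReal.zero_rpow_of_pos hp]

theorem aemeasurable_truncExtend (hΩ : MeasurableSet Ω) {u : Ω → EReal}
    (hu : AEMeasurable u (μ.comap (Subtype.val : Ω → X))) : AEMeasurable (truncExtend u) μ := by
  rw [← Measure.restrict_univ (μ := μ), ← union_compl_self Ω, aemeasurable_union_iff]
  constructor
  · rw [aemeasurable_restrict_iff_comap_subtype hΩ]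
    exact (measurable_unitTrunc.comp_aemeasurable hu).congr (.of_forall fun y => by simp)
  · exact (aemeasurable_const (b := (1 : ℝ))).congr
      ((ae_restrict_mem hΩ.compl).mono fun x hx => (truncExtend_of_notMem u hx).symm)

end Extension

theorem IsWeakUpperGradient.of_abs_sub_le {X : Type*} [MetricSpace X] [MeasurableSpace X] {p : ℝ}
    {μ : Measure X} {g : X → ℝ≥0∞} {f f' : X → EReal} (hg : IsWeakUpperGradient p μ g f)
    (h : ∀ x y, (f' x - f' y).abs ≤ (f x - f y).abs) : IsWeakUpperGradient p μ g f' := by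
  obtain ⟨hgm, ρ, hρm, hρ, hρΓ⟩ := hg
  exact ⟨hgm, ρ, hρm, hρ, fun γ hγ => hρΓ γ fun hle => hγ ((h _ _).trans hle)⟩

/-- If `u > 1 / 2` on `Ω` outside a closed set `K ⊆ Ω`, then a weak upper gradient of `u` on `Ω`
gives one for the extension of the truncation of `u` on the whole space. A curve that leaves `Ω`
passes from each of its endpoints in `Ω` to the set where the extension is `1` within `Ω`. Since
`|h a - h b| ≤ max (1 - h a) (1 - h b)` for `h` with values in `[0, 1]`, each endpoint can be
treated separately. -/
theorem isWeakUpperGradient_truncExtend {X : Type*} [MetricSpace X] [MeasurableSpace X]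
    [BorelSpace X] {μ : Measure X} {p : ℝ} (hp : 0 < p) {Ω K : Set X} (hΩ : IsOpen Ω)
    (hK : IsClosed K) (hKΩ : K ⊆ Ω) {u : Ω → EReal}
    (hu : ∀ y : Ω, (y : X) ∉ K → ((1 / 2 : ℝ) : EReal) < u y) {g : Ω → ℝ≥0∞}
    (hg : IsWeakUpperGradient p (μ.comap (Subtype.val : Ω → X)) g u) :
    IsWeakUpperGradient p μ (zeroExtend fun y => 2 * g y)
      (fun x => (truncExtend u x : EReal)) := by
  obtain ⟨hgm, ρ, hρm, hρ, hρΓ⟩ := hg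
  refine ⟨aemeasurable_zeroExtend hΩ.measurableSet (hgm.const_mul 2), zeroExtend ρ,
    (MeasurableEmbedding.subtype_coe hΩ.measurableSet).measurable_extend hρm measurable_zero,
    by rwa [lintegral_zeroExtend_rpow hΩ.measurableSet ρ hp], fun γ hγ => ?_⟩
  by_contra hfin
  refine hγ ?_
  have hpiece : ∀ δ : RectCurve X, δ.lineIntegral (zeroExtend ρ) ≠ ∞ → ∀ s ∈ Icc 0 δ.len,
      (∀ t ∈ Icc 0 s, δ.toFun t ∈ Ω) →
      ENNReal.ofReal |truncExtend u (δ.toFun 0) - truncExtend u (δ.toFun s)| ≤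
        δ.lineIntegral (zeroExtend fun y => 2 * g y) := by
    intro δ hδ s hs hsΩ
    rcases hs.1.eq_or_lt with rfl | hs0
    · simp
    set η := δ.initialPiece hs0 hs.2 hsΩ with hη
    have hρη : η.lineIntegral ρ ≠ ∞ := by
      refine ne_top_of_le_ne_top hδ ?_
      simpa using δ.lineIntegral_initialPiece_le hs0 hs.2 hsΩ (zeroExtend ρ)
    have hgη : (u (η.toFun 0) - u (η.toFun s)).abs ≤ η.lineIntegral g := by
      by_contra h
      exact hρη (hρΓ η h)
    rw [← δ.coe_initialPiece hs0 hs.2 hsΩ ⟨le_rfl, hs.1⟩,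
      ← δ.coe_initialPiece hs0 hs.2 hsΩ ⟨hs.1, le_rfl⟩, truncExtend_coe, truncExtend_coe]
    calc ENNReal.ofReal |unitTrunc (u (η.toFun 0)) - unitTrunc (u (η.toFun s))|
        ≤ 2 * (u (η.toFun 0) - u (η.toFun s)).abs := ofReal_abs_unitTrunc_sub_le _ _
      _ ≤ 2 * η.lineIntegral g := by gcongr
      _ = η.lineIntegral fun y => 2 * g y :=
        (lintegral_const_mul' 2 _ ENNReal.ofNat_ne_top).symm
      _ ≤ δ.lineIntegral (zeroExtend fun y => 2 * g y) := by
        simpa using δ.lineIntegral_initialPiece_le hs0 hs.2 hsΩ (zeroExtend fun y => 2 * g y)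
  have hexit : ∀ δ : RectCurve X, δ.lineIntegral (zeroExtend ρ) ≠ ∞ →
      (∃ t ∈ Icc 0 δ.len, δ.toFun t ∉ Ω) →
      ENNReal.ofReal (1 - truncExtend u (δ.toFun 0)) ≤
        δ.lineIntegral (zeroExtend fun y => 2 * g y) := by
    intro δ hδ hδΩ
    by_cases h0 : δ.toFun 0 ∈ Ω
    · obtain ⟨s, hs, hsK, hsΩ⟩ := RectCurve.exists_initial_subset hΩ hK hKΩ h0 hδΩ
      have hone : truncExtend u (δ.toFun s) = 1 := by
        have := unitTrunc_eq_one (hu ⟨δ.toFun s, hsΩ s ⟨hs.1, le_rfl⟩⟩ hsK)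
        rwa [← truncExtend_coe] at this
      refine le_trans (ENNReal.ofReal_le_ofReal ?_) (hpiece δ hδ s hs hsΩ)
      rw [hone, abs_sub_comm]
      exact le_abs_self _
    · simp [truncExtend_of_notMem u h0]
  rw [← EReal.coe_sub, EReal.abs_def]
  by_cases hall : ∀ t ∈ Icc 0 γ.len, γ.toFun t ∈ Ω
  · exact hpiece γ hfin γ.len ⟨γ.len_pos.le, le_rfl⟩ hall
  · push Not at hall
    have h1 := hexit γ hfin hall
    have h2 := hexit γ.reverse (by rwa [γ.lineIntegral_reverse]) (by
      obtain ⟨t, ht, h⟩ := hall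
      refine ⟨γ.len - t, ⟨sub_nonneg.2 ht.2, sub_le_self _ ht.1⟩, ?_⟩
      simpa [RectCurve.reverse] using h)
    rw [γ.lineIntegral_reverse] at h2
    simp only [RectCurve.reverse, sub_zero] at h2
    have ha := truncExtend_mem_Icc u (γ.toFun 0)
    have hb := truncExtend_mem_Icc u (γ.toFun γ.len)
    rcases le_total (truncExtend u (γ.toFun 0)) (truncExtend u (γ.toFun γ.len)) with h | h
    · refine le_trans (ENNReal.ofReal_le_ofReal ?_) h1
      rw [abs_sub_comm, abs_of_nonneg (sub_nonneg.2 h)]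
      linarith [hb.2]
    · refine le_trans (ENNReal.ofReal_le_ofReal ?_) h2
      rw [abs_of_nonneg (sub_nonneg.2 h)]
      linarith [ha.2]

/-! ### Functions admissible for the boundary of a compactification -/

/-- A function that is admissible for the boundary of a compactification is greater than `1 / 2`
outside a compact subset of `Ω`, because the boundary has a neighbourhood where it is. -/
theorem exists_isCompact_forall_half_lt {X : Type*} [MetricSpace X] [MeasurableSpace X]
    {Ω : Set X} {ν : Measure Ω} {p : ℝ} {Y : Type*} [TopologicalSpace Y] {ι : Ω → Y}
    (hι : IsCompactification ι) {u : Ω → EReal}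
    (hu : u ∈ capAdmissible p ν ι (compBoundary ι)) :
    ∃ K : Set X, IsCompact K ∧ K ⊆ Ω ∧
      ∀ y : Ω, (y : X) ∉ K → ((1 / 2 : ℝ) : EReal) < u y := by
  have := hι.compact
  have hnhds : ∀ x ∈ compBoundary ι, ∃ U : Set Y, IsOpen U ∧ x ∈ U ∧
      ∀ y, ι y ∈ U → ((1 / 2 : ℝ) : EReal) < u y := by
    intro x hx
    have hhalf : ((1 / 2 : ℝ) : EReal) < 1 := EReal.coe_lt_coe_iff.2 one_half_lt_one
    have hev := eventually_lt_of_lt_liminf (hhalf.trans_le (hu.2.2 x ⟨hx, hx⟩))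
    obtain ⟨V, hV, hVu⟩ := eventually_comap.1 hev |>.exists_mem
    obtain ⟨U, hUV, hU, hxU⟩ := mem_nhds_iff.1 hV
    exact ⟨U, hU, hxU, fun y hy => hVu _ (hUV hy) y rfl⟩
  choose! U hUo hxU hUu using hnhds
  set W : Set Y := ⋃ x ∈ compBoundary ι, U x with hW
  have hWo : IsOpen W := isOpen_biUnion fun x hx => hUo x hx
  have hWr : Wᶜ ⊆ range ι := by
    intro x hx
    by_contra hn
    exact hx (mem_biUnion hn (hxU x hn))
  have hcpt : IsCompact (ι ⁻¹' Wᶜ) :=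
    hι.embedding.isInducing.isCompact_preimage' hWo.isClosed_compl.isCompact hWr
  refine ⟨Subtype.val '' (ι ⁻¹' Wᶜ), hcpt.image continuous_subtype_val,
    Subtype.coe_image_subset _ _, fun y hy => ?_⟩
  have hyW : ι y ∈ W := by
    by_contra h
    exact hy ⟨y, h, rfl⟩
  obtain ⟨x, hx, hyx⟩ := mem_iUnion₂.1 hyW
  exact hUu x hx y hyx

theorem newtonNorm_rpow {X : Type*} [MetricSpace X] [MeasurableSpace X] {p : ℝ} (hp : p ≠ 0)
    (μ : Measure X) (f : X → EReal) :
    newtonNorm p μ f ^ p = ∫⁻ x, (f x).abs ^ p ∂μ +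
      ⨅ (g : X → ℝ≥0∞) (_ : IsWeakUpperGradient p μ g f), ∫⁻ x, g x ^ p ∂μ := by
  rw [newtonNorm, ← ENNReal.rpow_mul, one_div_mul_cancel hp, ENNReal.rpow_one]

/-- If the boundary of a compactification of `Ω` has zero capacity, then there are functions on the
whole space that equal `1` outside `Ω`, are arbitrarily small in `L^p(Ω)` and have arbitrarily
small weak upper gradients. -/
theorem exists_small_of_barCapacity_eq_zero {X : Type*} [MetricSpace X] [MeasurableSpace X]
    [BorelSpace X] {μ : Measure X} {p : ℝ} (hp : 0 < p) {Ω : Set X} (hΩ : IsOpen Ω)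
    {Y : Type*} [TopologicalSpace Y] {ι : Ω → Y} (hι : IsCompactification ι)
    (h0 : barCapacity p (μ.comap (Subtype.val : Ω → X)) ι (compBoundary ι) = 0)
    {ε : ℝ≥0∞} (hε : 0 < ε) :
    ∃ (h : X → ℝ) (G : X → ℝ≥0∞), (∀ x, h x ∈ Icc 0 1) ∧ (∀ x ∉ Ω, h x = 1) ∧ AEMeasurable h μ ∧
      IsWeakUpperGradient p μ G (fun x => (h x : EReal)) ∧
      ∫⁻ x in Ω, ENNReal.ofReal (h x) ^ p ∂μ < ε ∧ ∫⁻ x, G x ^ p ∂μ < ε := by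
  have h2 : (2 : ℝ≥0∞) ^ p ≠ 0 := (ENNReal.rpow_pos (by norm_num) (by norm_num)).ne'
  have h2t : (2 : ℝ≥0∞) ^ p ≠ ∞ := ENNReal.rpow_ne_top_of_nonneg hp.le (by norm_num)
  -- The truncation doubles the function and its gradient, which costs the factor `2 ^ p`.
  have hε' : 0 < ε / 2 ^ p := ENNReal.div_pos hε.ne' h2t
  rw [← h0, barCapacity] at hε'
  obtain ⟨u, hu⟩ := iInf_lt_iff.1 hε'
  obtain ⟨hadm, hu⟩ := iInf_lt_iff.1 hu
  rw [newtonNorm_rpow hp.ne'] at hu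
  have hgrad := lt_of_le_of_lt le_add_self hu
  have hfun := lt_of_le_of_lt le_self_add hu
  obtain ⟨g, hgrad⟩ := iInf_lt_iff.1 hgrad
  obtain ⟨hg, hgrad⟩ := iInf_lt_iff.1 hgrad
  obtain ⟨K, hK, hKΩ, huK⟩ := exists_isCompact_forall_half_lt hι hadm
  have hscale : ∀ f : Ω → ℝ≥0∞,
      ∫⁻ y, f y ^ p ∂(μ.comap (Subtype.val : Ω → X)) < ε / 2 ^ p →
      ∫⁻ y, (2 * f y) ^ p ∂(μ.comap (Subtype.val : Ω → X)) < ε := by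
    intro f hf
    simp_rw [ENNReal.mul_rpow_of_nonneg _ _ hp.le]
    rw [lintegral_const_mul' _ _ h2t, mul_comm]
    exact (ENNReal.lt_div_iff_mul_lt (.inl h2) (.inl h2t)).1 hf
  refine ⟨truncExtend u, zeroExtend fun y => 2 * g y, truncExtend_mem_Icc u,
    fun x hx => truncExtend_of_notMem u hx, aemeasurable_truncExtend hΩ.measurableSet hadm.1.1,
    isWeakUpperGradient_truncExtend hp hΩ hK.isClosed hKΩ huK hg, ?_, ?_⟩
  · rw [← lintegral_subtype_comap hΩ.measurableSet]
    refine lt_of_le_of_lt (lintegral_mono fun y => ?_) (hscale _ hfun)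
    simp only [truncExtend_coe, ofReal_unitTrunc]
    exact ENNReal.rpow_le_rpow (min_le_right _ _) hp.le
  · rw [lintegral_zeroExtend_rpow hΩ.measurableSet _ hp]
    exact hscale g hgrad

/-! ### Doubling measures and mean oscillation -/

theorem DoublingMeasure.measure_ball_pos {X : Type*} [MetricSpace X] [MeasurableSpace X]
    {μ : Measure X} (hμ : DoublingMeasure μ) (x : X) {r : ℝ} (hr : 0 < r) : 0 < μ (ball x r) := by
  obtain ⟨C, -, h⟩ := hμ
  simpa [mul_div_cancel₀] using (h x (r / 2) (half_pos hr)).1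

theorem DoublingMeasure.measure_ball_lt_top {X : Type*} [MetricSpace X] [MeasurableSpace X]
    {μ : Measure X} (hμ : DoublingMeasure μ) (x : X) {r : ℝ} (hr : 0 < r) : μ (ball x r) < ∞ := by
  obtain ⟨C, hC, h⟩ := hμ
  exact ENNReal.lt_top_of_mul_ne_top_right (h x r hr).2.2.ne (by simpa using hC.ne')

theorem DoublingMeasure.measure_pos_of_isOpen {X : Type*} [MetricSpace X] [MeasurableSpace X]
    {μ : Measure X} (hμ : DoublingMeasure μ) {U : Set X} (hU : IsOpen U) (hne : U.Nonempty) :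
    0 < μ U := by
  obtain ⟨x, hx⟩ := hne
  obtain ⟨r, hr, hrU⟩ := Metric.isOpen_iff.1 hU x hx
  exact (hμ.measure_ball_pos x hr).trans_le (measure_mono hrU)

/-- A nonnegative function that vanishes on `B \ A` has mean oscillation on `B` bounded from below
by its mean times the proportion of `B \ A` in `B`. -/
theorem setAverage_mul_le_setAverage_abs_sub {X : Type*} [MeasurableSpace X] {μ : Measure X}
    {A B : Set X} (hA : MeasurableSet A) (hB : MeasurableSet B) {w : X → ℝ}
    (hw : IntegrableOn w B μ) (hBt : μ B ≠ ∞) (h0 : ∀ x, 0 ≤ w x) (hzero : ∀ x ∉ A, w x = 0) :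
    (⨍ x in B, w x ∂μ) * (μ.real (B \ A) / μ.real B) ≤
      ⨍ x in B, |w x - ⨍ y in B, w y ∂μ| ∂μ := by
  set c := ⨍ y in B, w y ∂μ with hc
  have hc0 : 0 ≤ c := by
    rw [hc, setAverage_eq]
    exact mul_nonneg (by positivity) (integral_nonneg h0)
  have hint : IntegrableOn (fun x => |w x - c|) B μ :=
    (hw.sub (integrableOn_const hBt)).abs
  have hle : c * μ.real (B \ A) ≤ ∫ x in B, |w x - c| ∂μ := by
    calc c * μ.real (B \ A) = ∫ x in B \ A, |w x - c| ∂μ := by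
          rw [setIntegral_congr_fun (g := fun _ => c) (hB.diff hA)
            fun x hx => by simp [hzero x hx.2, abs_of_nonneg hc0]]
          rw [setIntegral_const, smul_eq_mul, mul_comm]
      _ ≤ ∫ x in B, |w x - c| ∂μ :=
          setIntegral_mono_set hint (.of_forall fun x => abs_nonneg _)
            (sdiff_subset.eventuallyLE)
  rw [setAverage_eq, smul_eq_mul, mul_div_assoc', div_eq_inv_mul]
  gcongr

/-- If `0 ≤ h ≤ 1` is small in `L^p(Ω)`, then `1 - h` has integral at least `μ(Ω) / 4` over `Ω`. -/
theorem quarter_le_setIntegral_one_sub {X : Type*} [MeasurableSpace X] {μ : Measure X}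
    {Ω : Set X} (hΩt : μ Ω ≠ ∞) {h : X → ℝ} (hm : AEMeasurable h μ)
    (h01 : ∀ x, h x ∈ Icc 0 1) {p : ℝ} (hp : 0 < p)
    (hsmall : ∫⁻ x in Ω, ENNReal.ofReal (h x) ^ p ∂μ ≤ μ Ω / (4 * 2 ^ p)) :
    μ.real Ω / 4 ≤ ∫ x in Ω, (1 - h x) ∂μ := by
  have h2t : (2 : ℝ≥0∞) ^ p ≠ ∞ := ENNReal.rpow_ne_top_of_nonneg hp.le (by norm_num)
  have h2 : (2 : ℝ≥0∞) ^ p ≠ 0 := (ENNReal.rpow_pos (by norm_num) (by norm_num)).ne'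
  have hpt : ∀ x, ENNReal.ofReal (h x) ≤
      ENNReal.ofReal (1 / 2) + 2 ^ p * ENNReal.ofReal (h x) ^ p := by
    intro x
    rcases le_total (h x) (1 / 2) with hx | hx
    · exact (ENNReal.ofReal_le_ofReal hx).trans le_self_add
    · refine le_trans ?_ le_add_self
      rw [← ENNReal.mul_rpow_of_nonneg _ _ hp.le]
      refine (ENNReal.ofReal_le_one.2 (h01 x).2).trans (ENNReal.one_le_rpow ?_ hp)
      rw [← ENNReal.ofReal_ofNat 2, ← ENNReal.ofReal_mul zero_le_two, ENNReal.one_le_ofReal]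
      linarith
  have hle : ∫⁻ x in Ω, ENNReal.ofReal (h x) ∂μ ≤ ENNReal.ofReal (3 / 4 * μ.real Ω) := by
    calc ∫⁻ x in Ω, ENNReal.ofReal (h x) ∂μ
        ≤ ∫⁻ x in Ω, (ENNReal.ofReal (1 / 2) + 2 ^ p * ENNReal.ofReal (h x) ^ p) ∂μ :=
          lintegral_mono hpt
      _ = ENNReal.ofReal (1 / 2) * μ Ω + 2 ^ p * ∫⁻ x in Ω, ENNReal.ofReal (h x) ^ p ∂μ := by
          rw [lintegral_add_left measurable_const, setLIntegral_const,
            lintegral_const_mul' _ _ h2t]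
      _ ≤ ENNReal.ofReal (1 / 2) * μ Ω + 2 ^ p * (μ Ω / (4 * 2 ^ p)) := by gcongr
      _ = ENNReal.ofReal (1 / 2) * μ Ω + ENNReal.ofReal (1 / 4) * μ Ω := by
          congr 1
          rw [div_eq_mul_inv, ENNReal.mul_inv (by simp) (by simp), ENNReal.ofReal_div_of_pos four_pos,
            ENNReal.ofReal_one, one_div, ENNReal.ofReal_ofNat]
          calc (2 : ℝ≥0∞) ^ p * (μ Ω * (4⁻¹ * (2 ^ p)⁻¹))
              = (2 ^ p * (2 ^ p)⁻¹) * (4⁻¹ * μ Ω) := by ring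
            _ = 4⁻¹ * μ Ω := by rw [ENNReal.mul_inv_cancel h2 h2t, one_mul]
      _ = ENNReal.ofReal (3 / 4 * μ.real Ω) := by
          rw [← add_mul, ← ENNReal.ofReal_add (by norm_num) (by norm_num),
            ENNReal.ofReal_mul (by norm_num), ofReal_measureReal hΩt]
          norm_num
  have hint : IntegrableOn h Ω μ := by
    refine Measure.integrableOn_of_bounded hΩt hm.aestronglyMeasurable (M := 1)
      (.of_forall fun x => ?_)
    rw [Real.norm_of_nonneg (h01 x).1]
    exact (h01 x).2
  have hreal : ∫ x in Ω, h x ∂μ ≤ 3 / 4 * μ.real Ω := by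
    rw [integral_eq_lintegral_of_nonneg_ae (.of_forall fun x => (h01 x).1)
      hint.aestronglyMeasurable]
    exact ENNReal.toReal_le_of_le_ofReal (by positivity) hle
  rw [integral_sub (integrableOn_const hΩt : IntegrableOn (fun _ => (1 : ℝ)) Ω μ) hint,
    setIntegral_const, smul_eq_mul]
  linarith

/-! ### Positivity of the boundary capacity -/

/-- `Ω` is regarded as a metric measure space in its own right: the subtype `↥Ω` of `X` with the
restricted metric and the restriction `μ.comap Subtype.val` of `μ`. -/
theorem proposition3p3 {X : Type*} [MetricSpace X] [CompleteSpace X] [MeasurableSpace X]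
    [BorelSpace X] (μ : Measure X) (p : ℝ) (hp : 1 < p) (hμ : DoublingMeasure μ)
    (hPI : SupportsPoincare p μ) (Ω : Set X) (hΩo : IsOpen Ω) (hΩne : Ω.Nonempty)
    (hΩb : Bornology.IsBounded Ω) (hΩc : 0 < sobolevCapacity p μ Ωᶜ)
    {Y : Type*} [TopologicalSpace Y] (ι : Ω → Y) (hι : IsCompactification ι) :
    0 < barCapacity p (μ.comap (Subtype.val : Ω → X)) ι (compBoundary ι) := by
  have hp0 : 0 < p := zero_lt_one.trans hp
  rw [pos_iff_ne_zero]
  intro h0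
  by_cases hnull : μ Ωᶜ = 0
  ·
    -- The functions that are small on `Ω` are small in `N^{1,p}(X)` and test the capacity of `Ωᶜ`.
    refine hΩc.ne' (le_antisymm (le_of_forall_gt fun ε hε => ?_) zero_le)
    obtain ⟨h, G, h01, hone, hm, hG, hLp, hGp⟩ :=
      exists_small_of_barCapacity_eq_zero hp0 hΩo hι h0 (ENNReal.half_pos hε.ne')
    have hfun : ∫⁻ x, ((h x : EReal)).abs ^ p ∂μ < ε / 2 := by
      rw [← setLIntegral_univ, ← union_compl_self Ω,
        setLIntegral_congr (union_ae_eq_left_of_ae_eq_empty (ae_eq_empty.2 hnull))]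
      simpa only [EReal.abs_def, abs_of_nonneg (h01 _).1] using hLp
    have hnorm : newtonNorm p μ (fun x => (h x : EReal)) ^ p < ε := by
      rw [newtonNorm_rpow hp0.ne', ← ENNReal.add_halves ε]
      exact ENNReal.add_lt_add hfun ((iInf₂_le G hG).trans_lt hGp)
    refine lt_of_le_of_lt (iInf₂_le _ ⟨⟨hm.coe_real_ereal, ?_⟩, fun x hx => ?_⟩) hnorm
    · by_contra htop
      rw [not_lt_top_iff.1 htop, ENNReal.top_rpow_of_pos hp0] at hnorm
      exact not_top_lt hnorm
    · simp [hone x hx]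
  ·
    -- On a large ball, `1 - h` is close to the indicator of `Ω`, which is not almost everywhere
    -- constant there, while its gradient is small.
    obtain ⟨x₀, hx₀⟩ := hΩne
    obtain ⟨R, hR, hΩR, hpos⟩ : ∃ R : ℝ, 0 < R ∧ Ω ⊆ ball x₀ R ∧ μ (ball x₀ R \ Ω) ≠ 0 := by
      obtain ⟨R, hR⟩ := hΩb.subset_ball x₀
      by_contra! hcon
      refine hnull (measure_mono_null (t := ⋃ n : ℕ, ball x₀ (max R 0 + n + 1) \ Ω) ?_ ?_)
      · intro x hx
        obtain ⟨n, hn⟩ := exists_nat_gt (dist x x₀)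
        refine mem_iUnion.2 ⟨n, ?_, hx⟩
        rw [mem_ball]
        linarith [le_max_right R 0]
      · refine measure_iUnion_null fun n => hcon _ (by positivity) (hR.trans (ball_subset_ball ?_))
        have : (0 : ℝ) ≤ n := n.cast_nonneg
        linarith [le_max_left R 0]
    obtain ⟨C, Λ, hC, hΛ, hPI⟩ := hPI
    have hBt := (hμ.measure_ball_lt_top x₀ hR).ne
    have hΩt : μ Ω ≠ ∞ := ne_top_of_le_ne_top hBt (measure_mono hΩR)
    have hΩpos : 0 < μ Ω := hμ.measure_pos_of_isOpen hΩo ⟨x₀, hx₀⟩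
    have hΛR : 0 < Λ * R := by positivity
    have hΛB := (hμ.measure_ball_pos x₀ hΛR).ne'
    set B := ball x₀ R with hB
    set M : ℝ := μ.real Ω / 4 / μ.real B * (μ.real (B \ Ω) / μ.real B) with hM
    have hMpos : 0 < M := by
      have h1 : 0 < μ.real Ω := ENNReal.toReal_pos hΩpos.ne' hΩt
      have h2 : 0 < μ.real B := ENNReal.toReal_pos (hμ.measure_ball_pos x₀ hR).ne' hBt
      have h3 : 0 < μ.real (B \ Ω) :=
        ENNReal.toReal_pos hpos (ne_top_of_le_ne_top hBt (measure_mono sdiff_subset))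
      positivity
    have hlim : Tendsto (fun ε : ℝ≥0∞ => ENNReal.ofReal (C * diam B) *
        (ε / μ (ball x₀ (Λ * R))) ^ (1 / p)) (𝓝[>] 0) (𝓝 0) := by
      have hdiv : Tendsto (fun ε : ℝ≥0∞ => ε / μ (ball x₀ (Λ * R))) (𝓝[>] 0) (𝓝 0) := by
        have := ENNReal.Tendsto.div_const (b := μ (ball x₀ (Λ * R)))
          (tendsto_id (α := ℝ≥0∞) (x := 𝓝 0)) (.inr hΛB)
        rw [ENNReal.zero_div] at this
        exact this.mono_left nhdsWithin_le_nhds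
      have hpow := (ENNReal.continuous_rpow_const (y := 1 / p)).tendsto 0 |>.comp hdiv
      rw [ENNReal.zero_rpow_of_pos (by positivity)] at hpow
      have := ENNReal.Tendsto.const_mul hpow (.inr (ENNReal.ofReal_ne_top (r := C * diam B)))
      rwa [mul_zero] at this
    have hδ : 0 < μ Ω / (4 * 2 ^ p) := ENNReal.div_pos hΩpos.ne'
      (ENNReal.mul_ne_top (by norm_num) (ENNReal.rpow_ne_top_of_nonneg hp0.le (by norm_num)))
    obtain ⟨ε, ⟨hεM, hεδ⟩, hε⟩ := ((hlim.eventually_lt_const (ENNReal.ofReal_pos.2 hMpos)).and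
      (nhdsWithin_le_nhds (eventually_lt_nhds hδ))).and self_mem_nhdsWithin |>.exists
    obtain ⟨h, G, h01, hone, hm, hG, hLp, hGp⟩ :=
      exists_small_of_barCapacity_eq_zero hp0 hΩo hι h0 hε
    have hzero : ∀ x ∉ Ω, 1 - h x = 0 := fun x hx => by rw [hone x hx, sub_self]
    have hint : Integrable (fun x => 1 - h x) μ := by
      refine IntegrableOn.integrable_of_forall_notMem_eq_zero (s := Ω) ?_ hzero
      refine Measure.integrableOn_of_bounded hΩt
        (hm.const_sub 1).aestronglyMeasurable (M := 1) (.of_forall fun x => ?_)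
      rw [Real.norm_of_nonneg (sub_nonneg.2 (h01 x).2)]
      linarith [(h01 x).1]
    have hG' : IsWeakUpperGradient p μ G (fun x => ((1 - h x : ℝ) : EReal)) := by
      refine hG.of_abs_sub_le fun x y => ?_
      rw [← EReal.coe_sub, ← EReal.coe_sub, EReal.abs_def, EReal.abs_def, sub_sub_sub_cancel_left,
        abs_sub_comm]
    have hmean : μ.real Ω / 4 / μ.real B ≤ ⨍ x in B, (1 - h x) ∂μ := by
      rw [setAverage_eq, smul_eq_mul, div_eq_inv_mul]
      gcongr
      refine (quarter_le_setIntegral_one_sub hΩt hm h01 hp0 (hLp.trans hεδ).le).trans ?_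
      exact setIntegral_mono_set hint.integrableOn
        (.of_forall fun x => sub_nonneg.2 (h01 x).2) hΩR.eventuallyLE
    have hlow : M ≤ ⨍ x in B, |(1 - h x) - ⨍ y in B, (1 - h y) ∂μ| ∂μ :=
      (mul_le_mul_of_nonneg_right hmean (by positivity)).trans
        (setAverage_mul_le_setAverage_abs_sub hΩo.measurableSet measurableSet_ball
          hint.integrableOn hBt (fun x => sub_nonneg.2 (h01 x).2) hzero)
    refine absurd (hPI x₀ R hR _ G hint hG') (not_le.2 ?_)
    refine lt_of_le_of_lt ?_ (hεM.trans_le (ENNReal.ofReal_le_ofReal hlow))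
    rw [setLAverage_eq]
    gcongr
    exact (setLIntegral_le_lintegral _ _).trans hGp.le
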